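/- Let $k$ be a commutative domain, let $K$ be an abstract simplicial complex on vertices $x_1,\dots,x_n$ (with $\varnothing\in K$), and let $R=R_K=k[x_1,\dots,x_n]/I_K$ be its face ring, where $I_K$ is generated by the square-free monomials $\prod_{x_i\in\rho}x_i$ with $\rho\notin K$. For $\sigma\in K$ let $st(\sigma)=\{\rho\in K\mid \rho\cup\sigma\in K\}$ be its closed star. For $f\in R$ let $supp(f)\subseteq\operatorname{Spec}R$ be the support of the $R$-module $fR$; for a subcomplex $L\subseteq K$, "$supp(f)=L$" means that $supp(f)$ is the cone on $L$, that is, the closed subset $V(I_L)$ of $\operatorname{Spec}R$. Let $D(R)=D_k(R)$ be the ring of $k$-linear differential operators on $R$. For $a,b\in\mathbb{N}^n$ put $x^a\partial^{(b)}=\prod_i x_i^{a_i}\prod_i\partial_i^{(b_i)}$ with $\partial_i^{(m)}=\frac1{m!}\frac{\partial^m}{\partial x_i^m}$ (the divided power operators, defined over any $k$). This is an element of the Weyl algebra, the ring of $k$-linear differential operators on $k[x_1,\dots,x_n]$; it is said to be in $D(R)$ if it descends to a differential operator on the quotient $R$. Let $a,b\in\mathbb{N}^n$ and $\sigma,\tau\in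 K$ be such that, for the classes of $x^a$ and $x^b$ in $R$, $supp(x^a)=st(\sigma)$ and $supp(x^b)=st(\tau)$. Then $x^a\partial^{(b)}$ is in $D(R)$ if and only if $st(\sigma)\subseteq st(\tau)$. -/

import Mathlib

namespace FaceRings

open MvPolynomial

noncomputable section

/-- An abstract simplicial complex on the (potential) vertices `x_1, …, x_n`. As is usual for face
rings, the empty simplex is a face. (Mathlib's `AbstractSimplicialComplex` leaves out the empty
face, so it cannot express `st(∅) = K`; moreover it requires every singleton to be a face, which
fails for stars.) -/
@[ext]
structure Complex (n : ℕ) where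
  /-- The simplices (faces) of the complex. -/
  faces : Set (Finset (Fin n))
  empty_mem : ∅ ∈ faces
  down_closed : ∀ ⦃σ τ : Finset (Fin n)⦄, σ ∈ faces → τ ⊆ σ → τ ∈ faces

variable {n : ℕ}

/-- The closed star `st(σ, K) = {τ ∈ K | τ ∪ σ ∈ K}` of a face `σ`, a subcomplex of `K`. -/
def Complex.star (K : Complex n) {σ : Finset (Fin n)} (hσ : σ ∈ K.faces) : Complex n where
  faces := {τ | τ ∈ K.faces ∧ τ ∪ σ ∈ K.faces}
  empty_mem := ⟨K.empty_mem, by simpa using hσ⟩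
  down_closed := fun _ _ h hs =>
    ⟨K.down_closed h.1 hs, K.down_closed h.2 (Finset.union_subset_union_left hs)⟩

variable (k : Type*) [CommRing k]

/-- The face ideal `I_K`, generated by the square-free monomials `x_σ` of the non-faces `σ`. -/
def faceIdeal (K : Complex n) : Ideal (MvPolynomial (Fin n) k) :=
  Ideal.span {f | ∃ σ : Finset (Fin n), σ ∉ K.faces ∧ f = ∏ i ∈ σ, X i}

/-- The Stanley-Reisner ring (face ring) `R_K = k[x_1, …, x_n] / I_K`. -/
abbrev FaceRing (K : Complex n) : Type _ := MvPolynomial (Fin n) k ⧸ faceIdeal k K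

/-- The class in `R_K` of the monomial `x^a`. -/
def mon (K : Complex n) (a : Fin n →₀ ℕ) : FaceRing k K :=
  Ideal.Quotient.mk (faceIdeal k K) (monomial a 1)

/-- The cone on a subcomplex `L` of `K`, as a closed subset of `Spec R_K`: the closed subscheme
`Spec R_L`, cut out by the image of `I_L` in `R_K`. -/
def cone (K L : Complex n) : Set (PrimeSpectrum (FaceRing k K)) :=
  PrimeSpectrum.zeroLocus ((faceIdeal k L).map (Ideal.Quotient.mk (faceIdeal k K)))

/-- The support of an element `f` of `R_K`: the support of the principal ideal `⟨f⟩`, considered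
as an `R_K`-module. -/
def supp (K : Complex n) (f : FaceRing k K) : Set (PrimeSpectrum (FaceRing k K)) :=
  Module.support (FaceRing k K) (Ideal.span {f})

/-- `D^m_k(R)`, the `k`-linear differential operators of order at most `m` on a `k`-algebra `R`:
`D^0_k(R)` consists of the multiplications by elements of `R`, and `φ ∈ D^{m+1}_k(R)` if and only
if `[φ, r] ∈ D^m_k(R)` for all `r ∈ R`. -/
def diffOpsOfOrder (R : Type*) [CommRing R] [Algebra k R] : ℕ → Set (Module.End k R)
  | 0 => {φ | ∃ r : R, φ = LinearMap.mulLeft k r}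
  | m + 1 => {φ | ∀ r : R,
      φ * LinearMap.mulLeft k r - LinearMap.mulLeft k r * φ ∈ diffOpsOfOrder R m}

/-- `D_k(R) = ⋃ m, D^m_k(R)`, the `k`-linear differential operators on `R`. -/
def diffOps (R : Type*) [CommRing R] [Algebra k R] : Set (Module.End k R) :=
  ⋃ m : ℕ, diffOpsOfOrder k R m

/-- The divided power operator `∂^(b) = ∏ i, ∂_i^(b_i)` on `k[x_1, …, x_n]`, where
`∂_i^(m) = (1 / m!) ∂^m / ∂ x_i^m`. It is given, over any `k`, by
`∂^(b) x^c = (∏ i, binom (c_i) (b_i)) x^(c - b)` (zero if some `b_i > c_i`, as the binomial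
coefficient then vanishes). -/
def dividedPower (b : Fin n →₀ ℕ) : Module.End k (MvPolynomial (Fin n) k) :=
  (basisMonomials (Fin n) k).constr k fun c =>
    monomial (c - b) ((∏ i, (c i).choose (b i) : ℕ) : k)

/-- The element `x^a ∂^(b)` of the Weyl algebra. -/
def weylMonomial (a b : Fin n →₀ ℕ) : Module.End k (MvPolynomial (Fin n) k) :=
  LinearMap.mulLeft k (monomial a 1) * dividedPower k b

/-- An operator `θ` on `k[x_1, …, x_n]` lies in `D(R_K)`: it descends along the quotient map
`k[x_1, …, x_n] → R_K` to a differential operator on `R_K`. -/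
def LiesInD (K : Complex n) (θ : Module.End k (MvPolynomial (Fin n) k)) : Prop :=
  ∃ φ ∈ diffOps k (FaceRing k K), ∀ f : MvPolynomial (Fin n) k,
    φ (Ideal.Quotient.mk (faceIdeal k K) f) = Ideal.Quotient.mk (faceIdeal k K) (θ f)

end

end FaceRings

/-! Both sides reduce to the combinatorics of faces. For a face `ρ`, the variables outside `ρ`
generate a prime `P_ρ` of `R_K`, since `k` is a domain. These points suffice: `P_ρ` lies in the cone
on `L` iff `ρ ∈ L`, and in `supp(x^a)` iff `ρ ∪ supp a ∈ K`. The hypotheses thus say that `ρ ∪ supp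
a ∈ K` iff `ρ ∈ st(σ)`, and likewise for `b` and `τ` (`union_support_mem_iff_of_supp_eq_cone`). On
the other side, `x^a ∂^(b)` descends iff it preserves `I_K`. It sends each monomial to a scalar
times a monomial and `I_K` is a monomial ideal, so this too is a condition on supports
(`liesInD_weylMonomial_iff`). -/

namespace FaceRings

open MvPolynomial

/-! ### The face ideal as a monomial ideal. -/

section FaceIdeal

variable {n : ℕ} (k : Type*) [CommRing k]

lemma prod_X_eq_monomial (ρ : Finset (Fin n)) :
    (∏ i ∈ ρ, X i : MvPolynomial (Fin n) k) = monomial (∑ i ∈ ρ, Finsupp.single i 1) 1 := by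
  rw [monomial_sum_one]
  rfl

lemma monomial_mem_faceIdeal (K : Complex n) {c : Fin n →₀ ℕ} (hc : c.support ∉ K.faces) (r : k) :
    monomial c r ∈ faceIdeal k K := by
  have h : (∏ i ∈ c.support, X i : MvPolynomial (Fin n) k) ∣ monomial c r := by
    rw [monomial_eq]
    exact Dvd.dvd.mul_left (Finset.prod_dvd_prod_of_dvd _ _ fun i hi =>
      dvd_pow_self _ (Finsupp.mem_support_iff.mp hi)) _
  exact Ideal.mem_of_dvd _ h (Ideal.subset_span ⟨_, hc, rfl⟩)

/-- The retraction of `k[x_1, …, x_n]` that sends the variables outside of `ρ` to zero. -/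
noncomputable def restrictVars (ρ : Finset (Fin n)) :
    MvPolynomial (Fin n) k →ₐ[k] MvPolynomial (Fin n) k :=
  aeval fun i => if i ∈ ρ then X i else 0

lemma restrictVars_X_of_mem {ρ : Finset (Fin n)} {i : Fin n} (hi : i ∈ ρ) :
    restrictVars k ρ (X i) = X i := by
  simp [restrictVars, hi]

lemma restrictVars_X_of_notMem {ρ : Finset (Fin n)} {i : Fin n} (hi : i ∉ ρ) :
    restrictVars k ρ (X i) = 0 := by
  simp [restrictVars, hi]

lemma restrictVars_monomial_of_subset {ρ : Finset (Fin n)} {c : Fin n →₀ ℕ} (h : c.support ⊆ ρ) :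
    restrictVars k ρ (monomial c 1) = monomial c 1 := by
  rw [monomial_eq, C_1, one_mul, Finsupp.prod, map_prod]
  refine Finset.prod_congr rfl fun i hi => ?_
  rw [map_pow, restrictVars_X_of_mem k (h hi)]

lemma restrictVars_comp {ρ μ : Finset (Fin n)} (h : ρ ⊆ μ) (f : MvPolynomial (Fin n) k) :
    restrictVars k ρ (restrictVars k μ f) = restrictVars k ρ f := by
  have : (restrictVars k ρ).comp (restrictVars k μ) = restrictVars k ρ := by
    refine MvPolynomial.algHom_ext fun i => ?_
    by_cases hi : i ∈ μ
    · simp [restrictVars_X_of_mem k hi]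
    · simp [restrictVars_X_of_notMem k hi, restrictVars_X_of_notMem k fun hρ => hi (h hρ)]
  exact DFunLike.congr_fun this f

lemma restrictVars_eq_zero_of_mem_faceIdeal (K : Complex n) {ρ : Finset (Fin n)}
    (hρ : ρ ∈ K.faces) {f : MvPolynomial (Fin n) k} (hf : f ∈ faceIdeal k K) :
    restrictVars k ρ f = 0 := by
  suffices faceIdeal k K ≤ RingHom.ker (restrictVars k ρ) from this hf
  refine Ideal.span_le.mpr ?_
  rintro _ ⟨μ, hμ, rfl⟩
  have : ¬ μ ⊆ ρ := fun h => hμ (K.down_closed hρ h)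
  obtain ⟨i, hi, hiρ⟩ := Finset.not_subset.mp this
  rw [SetLike.mem_coe, RingHom.mem_ker, map_prod]
  exact Finset.prod_eq_zero hi (restrictVars_X_of_notMem k hiρ)

lemma monomial_mem_faceIdeal_iff [Nontrivial k] (K : Complex n) (c : Fin n →₀ ℕ) :
    monomial c 1 ∈ faceIdeal k K ↔ c.support ∉ K.faces := by
  refine ⟨fun h hc => ?_, fun h => monomial_mem_faceIdeal k K h 1⟩
  have := restrictVars_eq_zero_of_mem_faceIdeal k K hc h
  rw [restrictVars_monomial_of_subset k subset_rfl] at this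
  exact one_ne_zero (monomial_eq_zero.mp this)

lemma prod_X_mem_faceIdeal_iff [Nontrivial k] (L : Complex n) (ρ : Finset (Fin n)) :
    (∏ i ∈ ρ, X i : MvPolynomial (Fin n) k) ∈ faceIdeal k L ↔ ρ ∉ L.faces := by
  rw [prod_X_eq_monomial, monomial_mem_faceIdeal_iff]
  have : (∑ i ∈ ρ, Finsupp.single i 1 : Fin n →₀ ℕ).support = ρ := by
    ext j
    simp [Finsupp.finsetSum_apply, Finsupp.single_apply]
  rw [this]

/-- A `k`-linear map that sends each monomial of `I_K` into `I_K` preserves `I_K`. -/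
lemma map_mem_faceIdeal (K : Complex n) (θ : Module.End k (MvPolynomial (Fin n) k))
    (h : ∀ c : Fin n →₀ ℕ, c.support ∉ K.faces → θ (monomial c 1) ∈ faceIdeal k K)
    {f : MvPolynomial (Fin n) k} (hf : f ∈ faceIdeal k K) : θ f ∈ faceIdeal k K := by
  -- In a monomial ideal, every monomial occurring in a member is divisible by one of the
  -- generators.
  have key : ∀ c ∈ f.support, c.support ∉ K.faces := by
    intro c hc
    have hS : {f : MvPolynomial (Fin n) k | ∃ σ : Finset (Fin n), σ ∉ K.faces ∧ f = ∏ i ∈ σ, X i} =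
        (fun s => monomial s (1 : k)) ''
          {s | ∃ σ : Finset (Fin n), σ ∉ K.faces ∧ s = ∑ i ∈ σ, Finsupp.single i 1} := by
      ext g
      simp only [prod_X_eq_monomial, Set.mem_ofPred_eq, Set.mem_image]
      constructor
      · rintro ⟨σ, hσ, rfl⟩
        exact ⟨_, ⟨σ, hσ, rfl⟩, rfl⟩
      · rintro ⟨_, ⟨σ, hσ, rfl⟩, rfl⟩
        exact ⟨σ, hσ, rfl⟩
    rw [faceIdeal, hS, mem_ideal_span_monomial_image] at hf
    obtain ⟨_, ⟨σ, hσ, rfl⟩, hle⟩ := hf c hc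
    refine fun hcK => hσ (K.down_closed hcK fun i hi => ?_)
    have := hle i
    simp only [Finsupp.finsetSum_apply, Finsupp.single_apply, Finset.sum_ite_eq', hi,
      if_true] at this
    exact Finsupp.mem_support_iff.mpr (by omega)
  rw [f.as_sum, map_sum]
  refine Ideal.sum_mem _ fun c hc => ?_
  have : monomial c (coeff c f) = coeff c f • monomial c (1 : k) := by
    rw [smul_monomial, smul_eq_mul, mul_one]
  rw [this, map_smul]
  exact Submodule.smul_of_tower_mem _ _ (h c (key c hc))

end FaceIdeal

/-! ### Supports and cones, tested at the primes of faces. -/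

section Support

variable {n : ℕ} (k : Type*) [CommRing k] [IsDomain k]

/-- The prime of `R_K` generated by the variables outside of the face `ρ`. -/
noncomputable def facePrime (K : Complex n) {ρ : Finset (Fin n)} (hρ : ρ ∈ K.faces) :
    PrimeSpectrum (FaceRing k K) :=
  ⟨RingHom.ker (Ideal.Quotient.lift (faceIdeal k K) (restrictVars k ρ).toRingHom
      fun _ hf => restrictVars_eq_zero_of_mem_faceIdeal k K hρ hf), RingHom.ker_isPrime _⟩

lemma mk_mem_facePrime (K : Complex n) {ρ : Finset (Fin n)} (hρ : ρ ∈ K.faces)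
    (f : MvPolynomial (Fin n) k) :
    Ideal.Quotient.mk (faceIdeal k K) f ∈ (facePrime k K hρ).asIdeal ↔ restrictVars k ρ f = 0 :=
  Iff.rfl

lemma facePrime_mem_cone (K L : Complex n) {ρ : Finset (Fin n)} (hρ : ρ ∈ K.faces) :
    facePrime k K hρ ∈ cone k K L ↔ ρ ∈ L.faces := by
  rw [cone, PrimeSpectrum.mem_zeroLocus, SetLike.coe_subset_coe, Ideal.map_le_iff_le_comap]
  constructor
  · intro h
    by_contra hL
    have h0 := h ((prod_X_mem_faceIdeal_iff k L ρ).mpr hL)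
    rw [Ideal.mem_comap, mk_mem_facePrime, map_prod,
      Finset.prod_congr rfl fun i hi => restrictVars_X_of_mem k hi] at h0
    exact Finset.prod_ne_zero_iff.mpr (fun i _ => X_ne_zero i) h0
  · intro hL f hf
    exact (mk_mem_facePrime k K hρ f).mpr (restrictVars_eq_zero_of_mem_faceIdeal k L hL hf)

/-- If `ρ ∪ supp a` is not a face, then `∏ i ∈ ρ, X i` annihilates `x^a` but avoids the prime of
`ρ`. If it is a face and `f` annihilates `x^a`, restrict `f * x^a` to the variables of `ρ ∪ supp a`:
there `x^a` survives and cancels, so `f` restricts to zero, and a fortiori on `ρ`. -/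
lemma facePrime_mem_supp_mon (K : Complex n) (a : Fin n →₀ ℕ) {ρ : Finset (Fin n)}
    (hρ : ρ ∈ K.faces) :
    facePrime k K hρ ∈ supp k K (mon k K a) ↔ ρ ∪ a.support ∈ K.faces := by
  rw [supp, Module.support_eq_zeroLocus, PrimeSpectrum.mem_zeroLocus, SetLike.coe_subset_coe]
  have hann (f : MvPolynomial (Fin n) k) : Ideal.Quotient.mk (faceIdeal k K) f ∈
      Module.annihilator (FaceRing k K) (Ideal.span {mon k K a}) ↔
        f * monomial a 1 ∈ faceIdeal k K := by
    rw [← Ideal.Quotient.eq_zero_iff_mem (I := faceIdeal k K), map_mul]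
    exact Submodule.mem_annihilator_span_singleton _ _
  constructor
  · intro h
    by_contra hK
    have h0 : Ideal.Quotient.mk (faceIdeal k K) (∏ i ∈ ρ, X i) ∈ (facePrime k K hρ).asIdeal := by
      refine h ((hann _).mpr ?_)
      rw [prod_X_eq_monomial, monomial_mul, one_mul]
      refine monomial_mem_faceIdeal k K (fun hc => hK (K.down_closed hc fun i hi => ?_)) 1
      rw [Finsupp.mem_support_iff, Finsupp.add_apply, Finsupp.finsetSum_apply]
      rcases Finset.mem_union.mp hi with hi | hi
      · simp [Finsupp.single_apply, hi]
      · have := Finsupp.mem_support_iff.mp hi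
        omega
    rw [mk_mem_facePrime, map_prod,
      Finset.prod_congr rfl fun i hi => restrictVars_X_of_mem k hi] at h0
    exact Finset.prod_ne_zero_iff.mpr (fun i _ => X_ne_zero i) h0
  · intro hK g hg
    obtain ⟨f, rfl⟩ := Ideal.Quotient.mk_surjective g
    have h0 := restrictVars_eq_zero_of_mem_faceIdeal k K hK ((hann f).mp hg)
    rw [map_mul, restrictVars_monomial_of_subset k Finset.subset_union_right] at h0
    have h1 := (mul_eq_zero.mp h0).resolve_right fun h => one_ne_zero (monomial_eq_zero.mp h)
    rw [mk_mem_facePrime, ← restrictVars_comp k (Finset.subset_union_left (s₂ := a.support)), h1,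
      map_zero]

lemma union_support_mem_iff_of_supp_eq_cone (K : Complex n) (a : Fin n →₀ ℕ)
    {σ : Finset (Fin n)} (hσ : σ ∈ K.faces)
    (ha : supp k K (mon k K a) = cone k K (K.star hσ)) {ρ : Finset (Fin n)} (hρ : ρ ∈ K.faces) :
    ρ ∪ a.support ∈ K.faces ↔ ρ ∈ (K.star hσ).faces := by
  rw [← facePrime_mem_supp_mon k K a hρ, ha, facePrime_mem_cone]

end Support

/-! ### Differential operators and their passage to quotients. -/

section DiffOps

variable (k : Type*) [CommRing k] {R : Type*} [CommRing R] [Algebra k R]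

lemma add_mem_diffOpsOfOrder {m : ℕ} {φ ψ : Module.End k R} (hφ : φ ∈ diffOpsOfOrder k R m)
    (hψ : ψ ∈ diffOpsOfOrder k R m) : φ + ψ ∈ diffOpsOfOrder k R m := by
  induction m generalizing φ ψ with
  | zero =>
    obtain ⟨r, rfl⟩ := hφ
    obtain ⟨s, rfl⟩ := hψ
    exact ⟨r + s, by ext; simp [add_mul]⟩
  | succ m ih =>
    intro r
    convert ih (hφ r) (hψ r) using 1
    noncomm_ring

lemma mulLeft_mul_mem_diffOpsOfOrder {m : ℕ} {φ : Module.End k R}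
    (hφ : φ ∈ diffOpsOfOrder k R m) (s : R) :
    LinearMap.mulLeft k s * φ ∈ diffOpsOfOrder k R m := by
  induction m generalizing φ with
  | zero =>
    obtain ⟨r, rfl⟩ := hφ
    exact ⟨s * r, by ext; simp⟩
  | succ m ih =>
    intro r
    convert ih (hφ r) using 1
    ext x
    simp [mul_sub, mul_left_comm]

lemma mul_mulLeft_mem_diffOpsOfOrder {m : ℕ} {φ : Module.End k R}
    (hφ : φ ∈ diffOpsOfOrder k R m) (s : R) :
    φ * LinearMap.mulLeft k s ∈ diffOpsOfOrder k R m := by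
  induction m generalizing φ with
  | zero =>
    obtain ⟨r, rfl⟩ := hφ
    exact ⟨r * s, by ext; simp⟩
  | succ m ih =>
    intro r
    convert ih (hφ r) using 1
    ext x
    simp [mul_left_comm]

lemma zero_mem_diffOpsOfOrder (m : ℕ) : (0 : Module.End k R) ∈ diffOpsOfOrder k R m := by
  induction m with
  | zero => exact ⟨0, by ext; simp⟩
  | succ m ih =>
    intro r
    simpa using ih

/-- The elements whose commutator with `φ` is an operator of order at most `m`. -/
def commutatorSubalgebra (φ : Module.End k R) (m : ℕ) : Subalgebra k R where
  carrier := {r | φ * LinearMap.mulLeft k r - LinearMap.mulLeft k r * φ ∈ diffOpsOfOrder k R m}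
  mul_mem' := by
    intro r s hr hs
    -- Leibniz rule: `[φ, rs] = [φ, r] s + r [φ, s]`.
    have h := add_mem_diffOpsOfOrder k (mul_mulLeft_mem_diffOpsOfOrder k hr s)
      (mulLeft_mul_mem_diffOpsOfOrder k hs r)
    rw [Set.mem_ofPred_eq]
    convert h using 1
    ext x
    simp [mul_sub]
  add_mem' := by
    intro r s hr hs
    rw [Set.mem_ofPred_eq]
    convert add_mem_diffOpsOfOrder k hr hs using 1
    ext x
    simp [add_mul]
    ring
  algebraMap_mem' := by
    intro c
    rw [Set.mem_ofPred_eq]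
    convert zero_mem_diffOpsOfOrder k m using 1
    ext x
    simp [← Algebra.smul_def]

/-- A linear map that a differential operator induces on a quotient is a differential operator. -/
lemma mem_diffOpsOfOrder_of_surjective {S : Type*} [CommRing S] [Algebra k S] (π : S →ₐ[k] R)
    (hπ : Function.Surjective π) {m : ℕ} {θ : Module.End k S} {φ : Module.End k R}
    (hθ : θ ∈ diffOpsOfOrder k S m) (h : ∀ f, φ (π f) = π (θ f)) :
    φ ∈ diffOpsOfOrder k R m := by
  induction m generalizing θ φ with
  | zero =>
    obtain ⟨r, rfl⟩ := hθ
    refine ⟨π r, ?_⟩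
    ext x
    obtain ⟨f, rfl⟩ := hπ x
    simp [h]
  | succ m ih =>
    intro r
    obtain ⟨s, rfl⟩ := hπ r
    refine ih (hθ s) fun f => ?_
    simp only [LinearMap.sub_apply, Module.End.mul_apply, LinearMap.mulLeft_apply, map_sub, map_mul,
      ← h]

end DiffOps

/-! ### Monomials of the Weyl algebra. -/

section Weyl

variable {n : ℕ} (k : Type*) [CommRing k]

lemma dividedPower_monomial (b c : Fin n →₀ ℕ) :
    dividedPower k b (monomial c 1) =
      monomial (c - b) ((∏ i, (c i).choose (b i) : ℕ) : k) := by
  have := (basisMonomials (Fin n) k).constr_basis k (fun c =>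
    monomial (c - b) ((∏ i, (c i).choose (b i) : ℕ) : k)) c
  rwa [coe_basisMonomials] at this

lemma weylMonomial_monomial (a b c : Fin n →₀ ℕ) :
    weylMonomial k a b (monomial c 1) =
      monomial (a + (c - b)) ((∏ i, (c i).choose (b i) : ℕ) : k) := by
  rw [weylMonomial, Module.End.mul_apply, dividedPower_monomial, LinearMap.mulLeft_apply,
    monomial_mul, one_mul]

lemma prod_choose_eq_zero {b c : Fin n →₀ ℕ} (h : ¬ b ≤ c) :
    ∏ i, (c i).choose (b i) = 0 := by
  rw [Finsupp.le_def, not_forall] at h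
  obtain ⟨i, hi⟩ := h
  exact Finset.prod_eq_zero (Finset.mem_univ i) (Nat.choose_eq_zero_of_lt (not_le.mp hi))

lemma dividedPower_commutator_of_eq_zero {b : Fin n →₀ ℕ} {i : Fin n} (hi : b i = 0) :
    dividedPower k b * LinearMap.mulLeft k (X i) - LinearMap.mulLeft k (X i) * dividedPower k b =
      0 := by
  refine (basisMonomials (Fin n) k).ext fun c => ?_
  simp only [coe_basisMonomials, LinearMap.sub_apply, Module.End.mul_apply,
    LinearMap.mulLeft_apply, LinearMap.zero_apply, X, monomial_mul, dividedPower_monomial, one_mul]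
  have hchoose : ∏ j, ((Finsupp.single i 1 + c : Fin n →₀ ℕ) j).choose (b j) =
      ∏ j, (c j).choose (b j) := by
    refine Finset.prod_congr rfl fun j _ => ?_
    by_cases hj : i = j
    · subst hj; simp [hi]
    · simp [hj]
  have hsub : Finsupp.single i 1 + c - b = Finsupp.single i 1 + (c - b) := by
    ext j
    by_cases hj : i = j
    · subst hj; simp [hi]
    · simp [hj]
  rw [hchoose, hsub, sub_self]

/-- Pascal's rule in the `i`-th binomial coefficient; the other factors are unchanged. -/
lemma dividedPower_commutator_add_single (b : Fin n →₀ ℕ) (i : Fin n) :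
    dividedPower k (b + Finsupp.single i 1) * LinearMap.mulLeft k (X i) -
      LinearMap.mulLeft k (X i) * dividedPower k (b + Finsupp.single i 1) = dividedPower k b := by
  refine (basisMonomials (Fin n) k).ext fun c => ?_
  simp only [coe_basisMonomials, LinearMap.sub_apply, Module.End.mul_apply,
    LinearMap.mulLeft_apply, X, monomial_mul, dividedPower_monomial, one_mul]
  have hsub : Finsupp.single i 1 + c - (b + Finsupp.single i 1) = c - b := by
    rw [add_comm b, add_tsub_add_eq_tsub_left]
  have hprod : ∏ j, ((Finsupp.single i 1 + c : Fin n →₀ ℕ) j).choose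
        ((b + Finsupp.single i 1 : Fin n →₀ ℕ) j) =
      ∏ j, (c j).choose ((b + Finsupp.single i 1 : Fin n →₀ ℕ) j) + ∏ j, (c j).choose (b j) := by
    rw [← Finset.mul_prod_erase _ _ (Finset.mem_univ i),
      ← Finset.mul_prod_erase _ (fun j => (c j).choose ((b + Finsupp.single i 1 : Fin n →₀ ℕ) j))
        (Finset.mem_univ i),
      ← Finset.mul_prod_erase _ (fun j => (c j).choose (b j)) (Finset.mem_univ i)]
    have h1 : ∏ j ∈ Finset.univ.erase i,
        ((Finsupp.single i 1 + c : Fin n →₀ ℕ) j).choose ((b + Finsupp.single i 1 : Fin n →₀ ℕ) j) =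
          ∏ j ∈ Finset.univ.erase i, (c j).choose (b j) :=
      Finset.prod_congr rfl fun j hj => by
        simp [(Finset.ne_of_mem_erase hj).symm]
    have h2 : ∏ j ∈ Finset.univ.erase i, (c j).choose ((b + Finsupp.single i 1 : Fin n →₀ ℕ) j) =
          ∏ j ∈ Finset.univ.erase i, (c j).choose (b j) :=
      Finset.prod_congr rfl fun j hj => by
        simp [(Finset.ne_of_mem_erase hj).symm]
    rw [h1, h2, ← add_mul]
    simp only [Finsupp.add_apply, Finsupp.single_eq_same]
    rw [add_comm 1 (c i), Nat.choose_succ_succ', add_comm ((c i).choose (b i))]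
  rw [hsub, hprod, Nat.cast_add, map_add]
  -- The exponents agree only when the subtraction is not truncated; otherwise the coefficient
  -- vanishes.
  by_cases h : b + Finsupp.single i 1 ≤ c
  · have : Finsupp.single i 1 + (c - (b + Finsupp.single i 1)) = c - b := by
      ext j
      have := h j
      simp only [Finsupp.add_apply, Finsupp.tsub_apply] at this ⊢
      omega
    rw [this, add_sub_cancel_left]
  · rw [prod_choose_eq_zero h]
    simp

lemma dividedPower_zero : dividedPower k (0 : Fin n →₀ ℕ) = 1 := by
  refine (basisMonomials (Fin n) k).ext fun c => ?_
  simp [coe_basisMonomials, dividedPower_monomial]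

lemma dividedPower_mem_diffOpsOfOrder {m : ℕ} {b : Fin n →₀ ℕ} (hb : b.degree ≤ m) :
    dividedPower k b ∈ diffOpsOfOrder k (MvPolynomial (Fin n) k) m := by
  induction m generalizing b with
  | zero =>
    rw [(Finsupp.degree_eq_zero_iff b).mp (Nat.le_zero.mp hb), dividedPower_zero]
    exact ⟨1, by simp [LinearMap.mulLeft_one]; rfl⟩
  | succ m ih =>
    intro f
    -- The admissible `f` form a subalgebra, so it is enough to commute with the variables.
    suffices h : ⊤ ≤ commutatorSubalgebra k (dividedPower k b) m from h (Algebra.mem_top (x := f))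
    rw [← adjoin_range_X, Algebra.adjoin_le_iff]
    rintro _ ⟨i, rfl⟩
    change _ ∈ diffOpsOfOrder k _ m
    by_cases hi : b i = 0
    · rw [dividedPower_commutator_of_eq_zero k hi]
      exact zero_mem_diffOpsOfOrder k m
    · have hle : Finsupp.single i 1 ≤ b :=
        Finsupp.single_le_iff.mpr (Nat.one_le_iff_ne_zero.mpr hi)
      obtain ⟨b', rfl⟩ : ∃ b', b = b' + Finsupp.single i 1 := ⟨_, (tsub_add_cancel_of_le hle).symm⟩
      rw [dividedPower_commutator_add_single]
      refine ih ?_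
      rw [map_add, Finsupp.degree_single] at hb
      omega

lemma weylMonomial_mem_diffOpsOfOrder (a b : Fin n →₀ ℕ) :
    weylMonomial k a b ∈ diffOpsOfOrder k (MvPolynomial (Fin n) k) b.degree :=
  mulLeft_mul_mem_diffOpsOfOrder k (dividedPower_mem_diffOpsOfOrder k le_rfl) _

/-- An element of the Weyl algebra lies in `D(R_K)` as soon as it preserves `I_K`. -/
lemma liesInD_weylMonomial_of_map_mem (K : Complex n) (a b : Fin n →₀ ℕ)
    (h : ∀ f ∈ faceIdeal k K, weylMonomial k a b f ∈ faceIdeal k K) :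
    LiesInD k K (weylMonomial k a b) := by
  let I := (faceIdeal k K).restrictScalars k
  have hI : I ≤ I.comap (weylMonomial k a b) := h
  let φ : Module.End k (FaceRing k K) := I.mapQ I (weylMonomial k a b) hI
  have hφ : ∀ f, φ (Ideal.Quotient.mk (faceIdeal k K) f) =
      Ideal.Quotient.mk (faceIdeal k K) (weylMonomial k a b f) := fun f => rfl
  exact ⟨φ, Set.mem_iUnion.mpr ⟨b.degree, mem_diffOpsOfOrder_of_surjective k
    (Ideal.Quotient.mkₐ k (faceIdeal k K)) Ideal.Quotient.mk_surjective
    (weylMonomial_mem_diffOpsOfOrder k a b) hφ⟩, hφ⟩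

lemma LiesInD.map_mem {K : Complex n} {θ : Module.End k (MvPolynomial (Fin n) k)}
    (h : LiesInD k K θ) {f : MvPolynomial (Fin n) k} (hf : f ∈ faceIdeal k K) :
    θ f ∈ faceIdeal k K := by
  obtain ⟨φ, -, hφ⟩ := h
  rw [← Ideal.Quotient.eq_zero_iff_mem, ← hφ, Ideal.Quotient.eq_zero_iff_mem.mpr hf, map_zero]

lemma liesInD_weylMonomial_iff [Nontrivial k] (K : Complex n) (a b : Fin n →₀ ℕ) :
    LiesInD k K (weylMonomial k a b) ↔
      ∀ ρ ∈ K.faces, ρ ∪ a.support ∈ K.faces → ρ ∪ b.support ∈ K.faces := by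
  constructor
  · intro h ρ _ hρa
    by_contra hρb
    -- A monomial with support `ρ ∪ supp b` and exponents exactly `b` on `supp b`: every binomial
    -- factor is `1`, so the coefficient survives in any characteristic, and `∂^(b)` leaves only
    -- variables of `ρ`.
    let c : Fin n →₀ ℕ := Finsupp.equivFunOnFinite.symm fun i =>
      if b i = 0 then (if i ∈ ρ then 1 else 0) else b i
    have hc (i : Fin n) : c i = if b i = 0 then (if i ∈ ρ then 1 else 0) else b i := rfl
    have hsupp : c.support = ρ ∪ b.support := by
      ext i
      rw [Finset.mem_union, Finsupp.mem_support_iff, Finsupp.mem_support_iff, hc]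
      split_ifs <;> simp_all
    have hchoose : ∏ i, (c i).choose (b i) = 1 := by
      refine Finset.prod_eq_one fun i _ => ?_
      rw [hc]
      split_ifs with h0 <;> simp [h0]
    have hmem := h.map_mem k (monomial_mem_faceIdeal k K (hsupp ▸ hρb) 1)
    rw [weylMonomial_monomial, hchoose, Nat.cast_one, monomial_mem_faceIdeal_iff] at hmem
    refine hmem (K.down_closed hρa fun i hi => ?_)
    rw [Finsupp.mem_support_iff, Finsupp.add_apply, Finsupp.tsub_apply, hc] at hi
    rw [Finset.mem_union, Finsupp.mem_support_iff]
    split_ifs at hi <;> simp_all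
  · intro h
    refine liesInD_weylMonomial_of_map_mem k K a b fun f hf => map_mem_faceIdeal k K _ ?_ hf
    intro c hc
    rw [weylMonomial_monomial]
    refine monomial_mem_faceIdeal k K (fun hac => hc ?_) _
    -- Apply the hypothesis to `ρ = supp (c - b)`: then `ρ ∪ supp b` is a face containing `supp c`.
    -- This holds for truncated subtraction, so `b ≤ c` is not needed.
    have hunion : (c - b).support ∪ a.support ∈ K.faces := by
      refine K.down_closed hac fun i hi => ?_
      simp only [Finset.mem_union, Finsupp.mem_support_iff, Finsupp.add_apply] at hi ⊢
      omega
    refine K.down_closed (h _ (K.down_closed hunion Finset.subset_union_left) hunion)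
      fun i hi => ?_
    simp only [Finset.mem_union, Finsupp.mem_support_iff, Finsupp.tsub_apply] at hi ⊢
    omega

end Weyl

end FaceRings

theorem mainTheorem5 {k : Type*} [CommRing k] [IsDomain k] {n : ℕ} (K : FaceRings.Complex n)
    (a b : Fin n →₀ ℕ) {σ τ : Finset (Fin n)} (hσ : σ ∈ K.faces) (hτ : τ ∈ K.faces)
    (ha : FaceRings.supp k K (FaceRings.mon k K a) = FaceRings.cone k K (K.star hσ))
    (hb : FaceRings.supp k K (FaceRings.mon k K b) = FaceRings.cone k K (K.star hτ)) :
    FaceRings.LiesInD k K (FaceRings.weylMonomial k a b) ↔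
      (K.star hσ).faces ⊆ (K.star hτ).faces := by
  rw [FaceRings.liesInD_weylMonomial_iff]
  constructor
  · intro h ρ hρ
    exact (FaceRings.union_support_mem_iff_of_supp_eq_cone k K b hτ hb hρ.1).mp
      (h ρ hρ.1 ((FaceRings.union_support_mem_iff_of_supp_eq_cone k K a hσ ha hρ.1).mpr hρ))
  · intro h ρ hρ hρa
    exact (FaceRings.union_support_mem_iff_of_supp_eq_cone k K b hτ hb hρ).mpr
      (h ((FaceRings.union_support_mem_iff_of_supp_eq_cone k K a hσ ha hρ).mp hρa))
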